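/- Let $\mathfrak m$ be an infinite cardinal and let $\mathbf{Pro}_{\mathfrak m}$ be the class of all profinite groups whose weight (the least cardinality of a base of the topology) is at most $\mathfrak m$. A topological group $G$ is called surjectively universal in $\mathbf{Pro}_{\mathfrak m}$ if $G\in\mathbf{Pro}_{\mathfrak m}$ and every $H\in\mathbf{Pro}_{\mathfrak m}$ is topologically isomorphic to a topological factor group $G/N$ of $G$. For a Stone space (compact Hausdorff zero-dimensional space) $X$, a free profinite group over $X$ is a profinite group $F_{Pro}(X)$ together with a continuous map $i\colon X\to F_{Pro}(X)$ such that for every continuous map $\varphi$ from $X$ to a profinite group $G$ there is a unique continuous homomorphism $\Phi\colon F_{Pro}(X)\to G$ with $\Phi\circ i=\varphi$. 1. There exists a surjectively universal group in the class $\mathbf{Pro}_{\mathfrak m}$; namely, the free profinite group $F_{Pro}(\{0,1\}^{\mathfrak m})$ over the Cantor cube $\{0,1\}^{\mathfrak m}$ exists and is surjectively universal in $\mathbf{Pro}_{\mathfrak m}$. 2. More generally, for every infinite Stone space $X$ of weight $\mathfrak m$, the free profinite group $F_{Pro}(X)$ exists and is surjectively universal in $\mathbf{Pro}_{\mathfrak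 m}$. -/

import Mathlib

open Cardinal TopologicalSpace

universe u

/-- The weight of a topological space: the least cardinality of a base of its topology. -/
noncomputable def topWeight (X : Type u) [TopologicalSpace X] : Cardinal.{u} :=
  sInf {κ : Cardinal.{u} | ∃ B : Set (Set X), IsTopologicalBasis B ∧ #B = κ}

/-- The class of all profinite groups of weight at most `m`. -/
def ProOfWeightLE (m : Cardinal.{u}) : Set ProfiniteGrp.{u} :=
  {G | topWeight G ≤ m}

/-- `G` is surjectively universal in the class `Ω`: it belongs to `Ω`, and every member of `Ω`
is topologically isomorphic to a topological factor group (a quotient by a normal subgroup, with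
the quotient topology) of `G`. -/
def IsSurjectivelyUniversal (Ω : Set ProfiniteGrp.{u}) (G : ProfiniteGrp.{u}) : Prop :=
  G ∈ Ω ∧ ∀ H ∈ Ω, ∃ (N : Subgroup G) (_ : N.Normal), Nonempty ((G ⧸ N) ≃ₜ* H)

/-- The pair `(F, i)` is a free profinite group over the space `X`: `F` is a profinite group,
`i : X → F` is continuous, and every continuous map from `X` to a profinite group `G` factors
through `i` by a unique continuous homomorphism `F → G`. (For a compact Hausdorff `X`, continuous
maps into topological groups are the same as uniformly continuous ones.) -/
structure IsFreeProfiniteGroup (X : Type u) [TopologicalSpace X]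
    (F : ProfiniteGrp.{u}) (i : X → F) : Prop where
  continuous_i : Continuous i
  existsUnique_lift : ∀ (G : ProfiniteGrp.{u}) (φ : X → G), Continuous φ →
    ∃! Φ : F →ₜ* G, ∀ x, Φ (i x) = φ x

/-! The space `X` enters only through its clopen algebra, whose cardinality is the weight of an
infinite Stone space. Given that algebra of size `m`, two facts are needed.

The free group `F` is small: an open normal subgroup of `F` is determined by a finite multiplication
table and the finite clopen partition it induces on `X`, so there are at most `m` of them, and their
cosets form a base.

Every `H` of weight at most `m` is topologically generated by a continuous image of `X`
(`exists_continuous_generating_map`). The induced map `F → H` then has compact dense image, so it is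
onto and `H` is its quotient by the kernel. To build the map, take generators `s i` of `H`
converging to `1`, and clopen sets `C i`, none determined by finitely many earlier ones. Send `x` to
the ordered infinite product of the `s i` with `x ∈ C i`. Modulo an open normal subgroup the product
is finite, which gives convergence and continuity. If an open subgroup `V` contains all values but
not all `s i`, let `j` be the last index with `s j ∉ V`. Two points separated by `C j` but by no
relevant earlier set have products differing in a way that forces `s j ∈ V`. -/

theorem exists_equiv_linearOrder_wellFoundedLT (α : Type u) :
    ∃ (J : Type u) (_ : LinearOrder J) (_ : WellFoundedLT J), Nonempty (J ≃ α) := by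
  classical
  exact ⟨α, linearOrderOfSTO WellOrderingRel, ⟨WellOrderingRel.isWellOrder.wf⟩, ⟨Equiv.refl α⟩⟩

theorem Cardinal.mk_sigma_le_of_le {ι : Type u} {β : ι → Type u} {m : Cardinal.{u}}
    (hm : ℵ₀ ≤ m) (hι : #ι ≤ m) (hβ : ∀ i, #(β i) ≤ m) : #(Σ i, β i) ≤ m := by
  rw [mk_sigma]
  calc Cardinal.sum (fun i => #(β i)) ≤ Cardinal.sum (fun _ : ι => m) := sum_le_sum _ _ hβ
    _ = #ι * m := by simp
    _ ≤ m * m := mul_le_mul_left hι m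
    _ = m := mul_eq_self hm

theorem Cardinal.mk_finset_le_of_le {α : Type u} {m : Cardinal.{u}} (hm : ℵ₀ ≤ m)
    (hα : #α ≤ m) : #(Finset α) ≤ m := by
  cases finite_or_infinite α
  · exact (lt_aleph0_of_finite _).le.trans hm
  · rwa [mk_finset_of_infinite]

/-! ### Weight, clopen sets and independent families -/

section weight
variable {X : Type u} [TopologicalSpace X]

theorem exists_isTopologicalBasis_mk_eq_topWeight (X : Type u) [TopologicalSpace X] :
    ∃ B : Set (Set X), IsTopologicalBasis B ∧ #B = topWeight X :=
  csInf_mem (s := {κ : Cardinal.{u} | ∃ B : Set (Set X), IsTopologicalBasis B ∧ #B = κ})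
    ⟨_, _, isTopologicalBasis_opens, rfl⟩

theorem topWeight_le_mk {B : Set (Set X)} (hB : IsTopologicalBasis B) : topWeight X ≤ #B :=
  csInf_le' ⟨B, hB, rfl⟩

/-- A clopen set is compact and open, hence a finite union of basic sets, and is encoded by them. -/
theorem mk_clopens_le_mk_finset [CompactSpace X] {B : Set (Set X)} (hB : IsTopologicalBasis B) :
    #(Clopens X) ≤ #(Finset B) := by
  have h : ∀ C : Clopens X, ∃ t : Finset B, (C : Set X) = ⋃ b ∈ t, (b : Set X) := by
    intro C
    obtain ⟨t, ht⟩ := eq_finite_iUnion_of_isTopologicalBasis_of_isCompact_open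
      (fun b : B => (b : Set X)) (by simpa using hB) C C.isClopen.isClosed.isCompact
      C.isClopen.isOpen
    exact ⟨ht.1.toFinset, by simpa using ht.2⟩
  choose t ht using h
  refine mk_le_of_injective (f := t) fun C D hCD => SetLike.coe_injective ?_
  rw [ht C, ht D, hCD]

theorem mk_clopens_le_of_topWeight_le [CompactSpace X] {m : Cardinal.{u}} (hm : ℵ₀ ≤ m)
    (h : topWeight X ≤ m) : #(Clopens X) ≤ m := by
  obtain ⟨B, hB, hBX⟩ := exists_isTopologicalBasis_mk_eq_topWeight X
  exact (mk_clopens_le_mk_finset hB).trans (mk_finset_le_of_le hm (hBX.trans_le h))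

theorem mk_clopens_le_topWeight [CompactSpace X] [Infinite (Clopens X)] :
    #(Clopens X) ≤ topWeight X := by
  obtain ⟨B, hB, hBX⟩ := exists_isTopologicalBasis_mk_eq_topWeight X
  have h := mk_clopens_le_mk_finset hB
  cases finite_or_infinite B
  · exact absurd (h.trans_lt (lt_aleph0_of_finite _)) (aleph0_le_mk (Clopens X)).not_gt
  · rwa [mk_finset_of_infinite, hBX] at h

theorem topWeight_le_mk_clopens [CompactSpace X] [T2Space X] [TotallyDisconnectedSpace X] :
    topWeight X ≤ #(Clopens X) := by
  refine (topWeight_le_mk isTopologicalBasis_isClopen).trans ?_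
  exact mk_le_of_injective (f := fun s : {s : Set X | IsClopen s} => (⟨s.1, s.2⟩ : Clopens X))
    fun s t h => Subtype.ext (congrArg Clopens.carrier h)

theorem topWeight_pi_bool {ι : Type u} [Infinite ι] : topWeight (ι → Bool) = #ι := by
  classical
  apply le_antisymm
  · let g : Set (Set (ι → Bool)) := Set.range fun p : ι × Bool => {x | x p.1 = p.2}
    have hg : (inferInstance : TopologicalSpace (ι → Bool)) = generateFrom g := by
      apply le_antisymm
      · refine le_generateFrom ?_
        rintro _ ⟨p, rfl⟩
        exact (isOpen_discrete {p.2}).preimage (f := fun x : ι → Bool => x p.1) (continuous_apply p.1)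
      · refine le_iInf fun i => ?_
        rw [← continuous_iff_le_induced]
        refine @continuous_discrete_rng _ _ (generateFrom g) _ _ _ |>.2 fun b => ?_
        exact isOpen_generateFrom_of_mem ⟨(i, b), rfl⟩
    have hgc : #g ≤ #ι := by
      refine mk_range_le.trans ?_
      simp only [mk_prod, mk_bool, lift_ofNat, lift_uzero]
      exact (mul_eq_left (aleph0_le_mk ι) (by exact (natCast_lt_aleph0 (n := 2)).le.trans (aleph0_le_mk ι))
        (by norm_num)).le
    refine (topWeight_le_mk (isTopologicalBasis_of_subbasis hg)).trans ?_
    refine le_trans ?_ (mk_finset_le_of_le (aleph0_le_mk ι) hgc)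
    refine mk_le_of_surjective
      (f := fun t : Finset g => ⟨⋂₀ (Subtype.val '' (t : Set g)), _, ⟨?_, ?_⟩, rfl⟩) ?_
    · exact t.finite_toSet.image _
    · rintro _ ⟨a, -, rfl⟩
      exact a.2
    · rintro ⟨_, f, ⟨hf, hfg⟩, rfl⟩
      refine ⟨(hf.preimage Subtype.val_injective.injOn).toFinset, Subtype.ext ?_⟩
      simp [Set.image_preimage_eq_of_subset, hfg]
  · have hinj : Function.Injective (fun i : ι =>
        (⟨{x | x i = true}, (isClopen_discrete {true}).preimage (continuous_apply i)⟩ :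
          Clopens (ι → Bool))) := by
      intro i j h
      have h' : ({x | x i = true} : Set (ι → Bool)) = {x | x j = true} :=
        congrArg Clopens.carrier h
      have : (fun k => decide (k = i)) ∈ ({x | x j = true} : Set (ι → Bool)) := by
        rw [← h']; simp
      have hji : j = i := by simpa using this
      exact hji.symm
    have := Infinite.of_injective _ hinj
    exact (mk_le_of_injective hinj).trans mk_clopens_le_topWeight

/-- Every infinite Boolean algebra of clopen sets contains a linearly ordered family of the same
cardinality, none of whose members is determined by finitely many earlier ones. -/
theorem exists_independent_clopens [Infinite (Clopens X)] :
    ∃ (J : Type u) (_ : LinearOrder J) (C : J → Clopens X), #J = #(Clopens X) ∧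
      ∀ (j : J) (T : Finset J), (∀ i ∈ T, i < j) →
        ∃ x ∈ C j, ∃ y ∉ C j, ∀ i ∈ T, (x ∈ C i ↔ y ∈ C i) := by
  classical
  obtain ⟨J, _, wf, ⟨c⟩⟩ := exists_equiv_linearOrder_wellFoundedLT (Clopens X)
  let good : Set J := {j | ∀ T : Finset J, (∀ i ∈ T, i < j) →
    ∃ x ∈ c j, ∃ y ∉ c j, ∀ i ∈ T, (x ∈ c i ↔ y ∈ c i)}
  refine ⟨good, inferInstance, fun j => c j, ?_, ?_⟩
  · have key : ∀ j : J, ∃ T : Finset good,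
        ∀ x y, (∀ i ∈ T, (x ∈ c i ↔ y ∈ c i)) → (x ∈ c j ↔ y ∈ c j) := by
      intro j
      induction j using wf.induction with
      | _ j ih =>
        by_cases hj : j ∈ good
        · exact ⟨{⟨j, hj⟩}, fun x y h => by simpa using h⟩
        · have hj' : ∃ T : Finset J, (∀ i ∈ T, i < j) ∧
              ∀ x ∈ c j, ∀ y ∉ c j, ¬ ∀ i ∈ T, (x ∈ c i ↔ y ∈ c i) := by
            by_contra! h
            exact hj h
          obtain ⟨T, hT, hTj⟩ := hj'
          choose! t ht using ih
          refine ⟨T.biUnion t, fun x y h => ?_⟩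
          have hi : ∀ i ∈ T, (x ∈ c i ↔ y ∈ c i) := fun i hiT =>
            ht i (hT i hiT) x y fun k hk => h k (Finset.mem_biUnion.2 ⟨i, hiT, hk⟩)
          by_contra hxy
          by_cases hx : x ∈ c j
          · exact hTj x hx y (fun hy => hxy ⟨fun _ => hy, fun _ => hx⟩) hi
          · have hy : y ∈ c j := by by_contra hy; exact hxy (by simp [hx, hy])
            exact hTj y hy x hx fun i hiT => (hi i hiT).symm
    choose t ht using key
    -- The traces on `t j` of the points of `c j`. Together with `t j` they recover `c j`, so there
    -- are no more clopen sets than good indices.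
    let A : J → Finset (Finset good) := fun j =>
      (t j).powerset.filter fun S => ∃ x ∈ c j, S = (t j).filter fun i : good => x ∈ c i
    have hinj : Function.Injective fun j => (t j, A j) := by
      have hle : ∀ j k, t j = t k → A j = A k → ∀ x ∈ c j, x ∈ c k := by
        intro j k h1 h2 x hx
        have : (t j).filter (fun i : good => x ∈ c i) ∈ A j := by
          simp only [A, Finset.mem_filter, Finset.mem_powerset, Finset.filter_subset, true_and]
          exact ⟨x, hx, rfl⟩
        rw [h2] at this
        obtain ⟨-, y, hy, hxy⟩ := Finset.mem_filter.1 this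
        refine (ht k x y fun i hi => ?_).2 hy
        rw [h1] at hxy
        simpa [hi] using Finset.ext_iff.1 hxy i
      intro j k h
      obtain ⟨h1, h2⟩ := Prod.mk.inj h
      exact c.injective
        (SetLike.ext fun x => ⟨hle j k h1 h2 x, hle k j h1.symm h2.symm x⟩)
    rw [← c.cardinal_eq]
    refine le_antisymm (mk_set_le _) ?_
    have hle := mk_le_of_injective hinj
    have : Infinite J := c.infinite_iff.2 inferInstance
    have hinf : Infinite good := by
      by_contra hfin
      rw [not_infinite_iff_finite] at hfin
      exact not_finite_iff_infinite.2 ‹Infinite J› (Finite.of_injective _ hinj)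
    simpa using hle
  · intro j T hT
    obtain ⟨x, hx, y, hy, h⟩ := j.2 (T.map (Function.Embedding.subtype _)) (by
      intro i hi
      obtain ⟨i, hiT, rfl⟩ := Finset.mem_map.1 hi
      exact hT i hiT)
    exact ⟨x, hx, y, hy, fun i hi => h i (Finset.mem_map.2 ⟨i, hi, rfl⟩)⟩

end weight

/-! ### Generators converging to `1` -/

section generators
variable {H : Type u} [Group H] [TopologicalSpace H] [IsTopologicalGroup H] [CompactSpace H]

/-- For a family of open normal subgroups indexed by a well-order, every element of the
intersection of the subgroups before `j` is congruent modulo the `j`-th one to an element `t` of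
that intersection which lies in each later subgroup not already excluded by the earlier ones. -/
theorem exists_normalized_representative {J : Type u} [LinearOrder J] [WellFoundedLT J]
    (U : J → OpenNormalSubgroup H) (j : J) (g : H) (hg : ∀ i < j, g ∈ U i) :
    ∃ t : H, (∀ i < j, t ∈ U i) ∧ g⁻¹ * t ∈ U j ∧
      ∀ k, j < k → (∃ n : H, (∀ i < k, n ∈ U i) ∧ t * n ∈ U k) → t ∈ U k := by
  -- One condition on `t` per index. Each `E k` is a union of cosets of `U k`, hence closed, so
  -- compactness reduces the claim to the conditions up to a given index.
  let E : J → Set H := fun k =>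
    if j < k then {t | (∃ n : H, (∀ i < k, n ∈ U i) ∧ t * n ∈ U k) → t ∈ U k}
    else if k = j then {t | g⁻¹ * t ∈ U j}
    else {t | t ∈ U k}
  have hmul : ∀ k, ∀ t ∈ E k, ∀ n ∈ U k, t * n ∈ E k := by
    intro k t ht n hn
    by_cases h1 : j < k
    · simp only [E, if_pos h1, Set.mem_ofPred_eq] at ht ⊢
      rintro ⟨n', hn', hk⟩
      refine mul_mem (ht ⟨n', hn', ?_⟩) hn
      have hc : n'⁻¹ * n * n' ∈ U k := by
        have := (U k).isNormal'.conj_mem n hn n'⁻¹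
        rwa [inv_inv] at this
      have : t * n * n' * (n'⁻¹ * n * n')⁻¹ ∈ U k := mul_mem hk (inv_mem hc)
      convert this using 1
      group
    · by_cases h2 : k = j
      · subst h2
        simp only [E, lt_irrefl, if_true, if_false, Set.mem_ofPred_eq] at ht ⊢
        rw [← mul_assoc]
        exact mul_mem ht hn
      · simp only [E, if_neg h1, if_neg h2, Set.mem_ofPred_eq] at ht ⊢
        exact mul_mem ht hn
  have hclosed : ∀ k, IsClosed (E k) := by
    intro k
    have hopen : ∀ s : Set H, (∀ t ∈ s, ∀ n ∈ U k, t * n ∈ s) → IsOpen s := by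
      intro s hs
      rw [isOpen_iff_mem_nhds]
      intro t ht
      have : (fun x => t⁻¹ * x) ⁻¹' (U k : Set H) ∈ nhds t :=
        (continuous_const_mul t⁻¹).continuousAt.preimage_mem_nhds
          (by rw [inv_mul_cancel]; exact (U k).toOpenSubgroup.mem_nhds_one)
      filter_upwards [this] with x hx
      simpa using hs t ht _ hx
    rw [← isOpen_compl_iff]
    refine hopen _ fun t ht n hn h => ht ?_
    simpa using hmul k _ h n⁻¹ (inv_mem hn)
  have hclosed' : ∀ l : J, IsClosed (⋂ i : {i // i ≤ l}, E i.1) :=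
    fun l => isClosed_iInter fun i : {i // i ≤ l} => hclosed i.1
  have hne : ∀ k : J, (⋂ i : {i // i ≤ k}, E i.1).Nonempty := by
    intro k
    induction k using (wellFounded_lt (α := J)).induction with
    | _ k ih =>
      have hlt : (⋂ i : {i // i < k}, E i.1).Nonempty := by
        cases isEmpty_or_nonempty {i // i < k}
        · simp
        · have := IsCompact.nonempty_iInter_of_directed_nonempty_isCompact_isClosed
            (fun l : {l // l < k} => ⋂ i : {i // i ≤ l.1}, E i.1)
            (by
              intro a b
              rcases le_total a b with h | h
              · exact ⟨b, Set.iInter_mono' fun i => ⟨⟨i.1, i.2.trans h⟩, subset_rfl⟩, subset_rfl⟩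
              · exact ⟨a, subset_rfl, Set.iInter_mono' fun i => ⟨⟨i.1, i.2.trans h⟩, subset_rfl⟩⟩)
            (fun l => ih l l.2)
            (fun l => (hclosed' l).isCompact)
            (fun l => hclosed' l)
          obtain ⟨t, ht⟩ := this
          refine ⟨t, Set.mem_iInter.2 fun l => ?_⟩
          exact Set.mem_iInter.1 (Set.mem_iInter.1 ht l) ⟨l.1, le_rfl⟩
      obtain ⟨t, ht⟩ := hlt
      have ht : ∀ i < k, t ∈ E i := fun i hi => Set.mem_iInter.1 ht ⟨i, hi⟩
      -- A correction `n` lying in all earlier `U i` preserves the earlier conditions, so only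
      -- condition `k` has to be arranged.
      suffices ∃ n, (∀ i < k, n ∈ U i) ∧ t * n ∈ E k by
        obtain ⟨n, hn, hk⟩ := this
        refine ⟨t * n, Set.mem_iInter.2 ?_⟩
        rintro ⟨i, hi⟩
        rcases hi.lt_or_eq with hi | rfl
        · exact hmul i t (ht i hi) n (hn i hi)
        · exact hk
      rcases lt_trichotomy j k with h | h | h
      · by_cases h' : ∃ n : H, (∀ i < k, n ∈ U i) ∧ t * n ∈ U k
        · obtain ⟨n, hn, hk⟩ := h'
          exact ⟨n, hn, by simp only [E, if_pos h, Set.mem_ofPred_eq]; exact fun _ => hk⟩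
        · refine ⟨1, fun i _ => one_mem _, ?_⟩
          simp only [E, if_pos h, Set.mem_ofPred_eq, mul_one]
          exact fun hh => absurd hh h'
      · subst h
        refine ⟨t⁻¹ * g, fun i hi => mul_mem (inv_mem ?_) (hg i hi), ?_⟩
        · simpa [E, hi.not_gt, hi.ne] using ht i hi
        · simp only [E, lt_irrefl, if_true, if_false, Set.mem_ofPred_eq]
          simp
      · refine ⟨t⁻¹, fun i hi => inv_mem ?_, ?_⟩
        · simpa [E, (hi.trans h).not_gt, (hi.trans h).ne] using ht i hi
        · simp [E, h.not_gt, h.ne]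
  obtain ⟨t, ht⟩ : (⋂ i, E i).Nonempty := by
    have : Nonempty J := ⟨j⟩
    have := IsCompact.nonempty_iInter_of_directed_nonempty_isCompact_isClosed
      (fun l : J => ⋂ i : {i // i ≤ l}, E i.1)
      (by
        intro a b
        rcases le_total a b with h | h
        · exact ⟨b, Set.iInter_mono' fun i => ⟨⟨i.1, i.2.trans h⟩, subset_rfl⟩, subset_rfl⟩
        · exact ⟨a, subset_rfl, Set.iInter_mono' fun i => ⟨⟨i.1, i.2.trans h⟩, subset_rfl⟩⟩)
      hne
      (fun l => (hclosed' l).isCompact)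
      (fun l => hclosed' l)
    obtain ⟨t, ht⟩ := this
    exact ⟨t, Set.mem_iInter.2 fun l =>
      Set.mem_iInter.1 (Set.mem_iInter.1 ht l) ⟨l, le_rfl⟩⟩
  have ht : ∀ i, t ∈ E i := fun i => Set.mem_iInter.1 ht i
  refine ⟨t, fun i hi => ?_, ?_, fun k hk => ?_⟩
  · simpa [E, hi.not_gt, hi.ne] using ht i
  · simpa [E] using ht j
  · simpa only [E, if_pos hk, Set.mem_ofPred_eq] using ht k

/-- Every profinite group has a family of generators converging to `1`, indexed by a set that is
no larger than the set of open normal subgroups if the latter is infinite. -/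
theorem exists_generators_converging_to_one (m : Cardinal.{u}) (hm : ℵ₀ ≤ m)
    (hH : #(OpenNormalSubgroup H) ≤ m) :
    ∃ (I : Type u) (s : I → H), #I ≤ m ∧
      (∀ U : OpenNormalSubgroup H, {i | s i ∉ U}.Finite) ∧
      ∀ (V : Subgroup H) (U : OpenNormalSubgroup H), U.toSubgroup ≤ V → (∀ i, s i ∈ V) →
        V = ⊤ := by
  classical
  obtain ⟨J, _, _, ⟨U⟩⟩ := exists_equiv_linearOrder_wellFoundedLT (OpenNormalSubgroup H)
  let good : J → H → Prop := fun j t => (∀ i < j, t ∈ U i) ∧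
      ∀ k, j < k → (∃ n : H, (∀ i < k, n ∈ U i) ∧ t * n ∈ U k) → t ∈ U k
  have hgood : ∀ (j : J) (c : H ⧸ (U j).toSubgroup), ∃ t : H, good j t ∧
      ((∃ g : H, (∀ i < j, g ∈ U i) ∧ (g : H ⧸ (U j).toSubgroup) = c) →
        (t : H ⧸ (U j).toSubgroup) = c) := by
    intro j c
    by_cases h : ∃ g : H, (∀ i < j, g ∈ U i) ∧ (g : H ⧸ (U j).toSubgroup) = c
    · obtain ⟨g, hg, rfl⟩ := h
      obtain ⟨t, h1, h2, h3⟩ := exists_normalized_representative U j g hg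
      exact ⟨t, ⟨h1, h3⟩, fun _ => (QuotientGroup.eq.2 h2).symm⟩
    -- A coset that misses the intersection of the earlier subgroups gets the harmless generator
    -- `1`.
    · exact ⟨1, ⟨fun i _ => one_mem _, fun k _ _ => one_mem _⟩, fun h' => absurd h' h⟩
  choose s hs hsc using hgood
  have hfin : ∀ j, Finite (H ⧸ (U j).toSubgroup) := fun j =>
    inferInstanceAs (Finite (H ⧸ (U j).toOpenSubgroup.toSubgroup))
  refine ⟨Σ j, H ⧸ (U j).toSubgroup, fun p => s p.1 p.2, ?_, ?_, ?_⟩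
  · exact mk_sigma_le_of_le hm (U.cardinal_eq.trans_le hH) fun j =>
      (lt_aleph0_of_finite _).le.trans hm
  · intro V
    obtain ⟨k, rfl⟩ := U.surjective V
    induction k using (wellFounded_lt (α := J)).induction with
    | _ k ih =>
      -- Let `M` be the intersection of the `U i` with `i < k`. The set `M * U k` is open and
      -- contains `M`, so by compactness it contains a finite subintersection. By normalization, a
      -- generator with index `j < k` outside `U k` is then outside one of finitely many earlier `U
      -- i`, where induction applies.
      have hcpt : ∃ T : Finset J, (∀ i ∈ T, i < k) ∧ ∀ t : H, (∀ i ∈ T, t ∈ U i) →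
          ∃ n : H, (∀ i < k, n ∈ U i) ∧ t * n ∈ U k := by
        let W : Set H := {t | ∃ n : H, (∀ i < k, n ∈ U i) ∧ t * n ∈ U k}
        have hW : IsOpen W := by
          have : W = ⋃ n ∈ {n : H | ∀ i < k, n ∈ U i}, (fun t => t * n) ⁻¹' (U k : Set H) := by
            ext t; simp [W]
          rw [this]
          exact isOpen_biUnion fun n _ =>
            (U k).toOpenSubgroup.isOpen.preimage (continuous_mul_const n)
        obtain ⟨T, hT⟩ := hW.isClosed_compl.isCompact.elim_finite_subfamily_closed
          (fun i : {i // i < k} => (U i.1 : Set H))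
          (fun i => (U i.1).toOpenSubgroup.isClosed) (by
            rw [Set.eq_empty_iff_forall_notMem]
            rintro t ⟨htW, ht⟩
            refine htW ⟨t⁻¹, fun i hi => inv_mem (Set.mem_iInter.1 ht ⟨i, hi⟩), ?_⟩
            simp)
        refine ⟨T.map (Function.Embedding.subtype _), fun i hi => ?_, fun t ht => ?_⟩
        · obtain ⟨i, -, rfl⟩ := Finset.mem_map.1 hi
          exact i.2
        · by_contra htW
          refine Set.eq_empty_iff_forall_notMem.1 hT t ⟨htW, Set.mem_iInter₂.2 fun i hi => ?_⟩
          exact ht i (Finset.mem_map.2 ⟨i, hi, rfl⟩)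
      obtain ⟨T, hT, hTk⟩ := hcpt
      refine Set.Finite.subset (s := (⋃ i ∈ T, {p : Σ j, H ⧸ (U j).toSubgroup | s p.1 p.2 ∉ U i}) ∪
        Sigma.mk k '' Set.univ) ?_ ?_
      · exact (T.finite_toSet.biUnion fun i hi => ih i (hT i hi)).union
          (Set.finite_univ.image _)
      · rintro ⟨j, c⟩ (hjc : s j c ∉ U k)
        rcases lt_trichotomy j k with h | h | h
        · left
          by_contra hh
          simp only [Set.mem_iUnion, Set.mem_ofPred_eq, not_exists, not_not] at hh
          exact hjc ((hs j c).2 k h (hTk _ hh))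
        · subst h
          exact Or.inr ⟨c, trivial, rfl⟩
        · exact absurd ((hs j c).1 k h) hjc
  · intro V V₀ hV₀ hV
    -- Successive approximation: `h` is corrected into `V` by elements of ever smaller
    -- intersections. Compactness handles the stage before `j`; the generator representing `n⁻¹`
    -- modulo `U j` then moves the correction into `U j`.
    have key : ∀ j, ∀ h : H, ∃ n : H, (∀ i ≤ j, n ∈ U i) ∧ h * n ∈ V := by
      intro j
      induction j using (wellFounded_lt (α := J)).induction with
      | _ j ih =>
        intro h
        have hVc : IsClosed (V : Set H) :=
          V.isClosed_of_isOpen (Subgroup.isOpen_mono hV₀ V₀.toOpenSubgroup.isOpen)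
        obtain ⟨n, hn, hhn⟩ : ∃ n : H, (∀ i < j, n ∈ U i) ∧ h * n ∈ V := by
          cases isEmpty_or_nonempty {i // i < j} with
          | inl he =>
            exact ⟨h⁻¹, fun i hi => (he.false ⟨i, hi⟩).elim, by simp⟩
          | inr he =>
            let A : {i // i < j} → Set H := fun l =>
              (⋂ i : {i // i ≤ l.1}, (U i : Set H)) ∩ (fun n => h * n) ⁻¹' (V : Set H)
            have hUc : ∀ i, IsClosed (U i : Set H) := fun i => (U i).toOpenSubgroup.isClosed
            have hA : ∀ l, IsClosed (A l) := fun l =>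
              (isClosed_iInter fun i : {i // i ≤ l.1} => hUc i.1).inter
                (hVc.preimage (continuous_const_mul h))
            have hmono : ∀ a b : {i // i < j}, a ≤ b → A b ⊆ A a := fun a b hab =>
              Set.inter_subset_inter_left _
                (Set.iInter_mono' fun i => ⟨⟨i.1, i.2.trans hab⟩, subset_rfl⟩)
            obtain ⟨n, hn⟩ := IsCompact.nonempty_iInter_of_directed_nonempty_isCompact_isClosed A
              (fun a b => (le_total a b).elim
                (fun hab => ⟨b, hmono a b hab, subset_rfl⟩)
                (fun hab => ⟨a, subset_rfl, hmono b a hab⟩))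
              (fun l => by
                obtain ⟨n, hn, hhn⟩ := ih l.1 l.2 h
                exact ⟨n, Set.mem_iInter.2 fun i => hn i.1 i.2, hhn⟩)
              (fun l => (hA l).isCompact) hA
            have hn := fun l => Set.mem_iInter.1 hn l
            exact ⟨n, fun i hi => Set.mem_iInter.1 (hn ⟨i, hi⟩).1 ⟨i, le_rfl⟩,
              (hn he.some).2⟩
        have ht := hs j ((n⁻¹ : H) : H ⧸ (U j).toSubgroup)
        have htc := hsc j ((n⁻¹ : H) : H ⧸ (U j).toSubgroup)
          ⟨n⁻¹, fun i hi => inv_mem (hn i hi), rfl⟩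
        have htV := hV ⟨j, ((n⁻¹ : H) : H ⧸ (U j).toSubgroup)⟩
        simp only at htV
        generalize s j ((n⁻¹ : H) : H ⧸ (U j).toSubgroup) = t at ht htc htV
        refine ⟨n * t, fun i hi => ?_, ?_⟩
        · rcases hi.lt_or_eq with hi | rfl
          · exact mul_mem (hn i hi) (ht.1 i hi)
          · have := QuotientGroup.eq.1 htc.symm
            rwa [inv_inv] at this
        · rw [← mul_assoc]
          exact mul_mem hhn htV
    rw [eq_top_iff]
    intro h _
    obtain ⟨n, hn, hhn⟩ := key (U.symm V₀) h
    have hnV := hn _ le_rfl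
    rw [U.apply_symm_apply] at hnV
    have : n ∈ V := hV₀ hnV
    simpa using mul_mem hhn (inv_mem this)

end generators

/-! ### Ordered products and the continuous generating map -/

theorem List.prod_map_filter_of_eq_one {α M : Type*} [Monoid M] (l : List α) (f : α → M)
    (p : α → Bool) (h : ∀ a ∈ l, p a = false → f a = 1) :
    ((l.filter p).map f).prod = (l.map f).prod := by
  induction l with
  | nil => rfl
  | cons a l ih =>
    have ih := ih fun b hb => h b (List.mem_cons_of_mem _ hb)
    cases hp : p a
    · rw [List.filter_cons_of_neg (by simp [hp]), ih, List.map_cons, List.prod_cons,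
        h a List.mem_cons_self hp, one_mul]
    · rw [List.filter_cons_of_pos hp, List.map_cons, List.prod_cons, ih, List.map_cons,
        List.prod_cons]

section orderedProd
variable {I : Type*} [LinearOrder I] {H : Type*} [Group H]

/-- The product of the elements `f i`, `i ∈ T`, in increasing order of the indices. -/
def Finset.orderedProd (T : Finset I) (f : I → H) : H := (T.sort.map f).prod

theorem Finset.orderedProd_congr {T : Finset I} {f g : I → H} (h : ∀ i ∈ T, f i = g i) :
    T.orderedProd f = T.orderedProd g :=
  congrArg List.prod (List.map_congr_left fun i hi => h i (by simpa using hi))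

/-- Modulo `V` the extra factors are trivial, and deleting them keeps the order of the rest. This
makes the finite products a compatible system. -/
theorem Finset.orderedProd_subset {T T' : Finset I} (hT : T ⊆ T') {f : I → H} (V : Subgroup H)
    [V.Normal] (h : ∀ i ∈ T', i ∉ T → f i ∈ V) :
    (T.orderedProd f)⁻¹ * T'.orderedProd f ∈ V := by
  rw [← QuotientGroup.eq]
  have hsort : T.sort = T'.sort.filter (· ∈ T) := by
    have hnd : (T'.sort.filter (· ∈ T)).Nodup := (T'.sort_nodup _).filter _
    have := (List.toFinset_sort (· ≤ ·) hnd).2 ((T'.pairwise_sort (· ≤ ·)).filter _)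
    rw [← this]
    congr 1
    ext i
    simpa using fun hi => hT hi
  have hmap : ∀ S : Finset I, ((S.orderedProd f : H) : H ⧸ V) =
      (S.sort.map fun i => (f i : H ⧸ V)).prod := by
    intro S
    simpa [Finset.orderedProd, Function.comp_def] using
      map_list_prod (QuotientGroup.mk' V) (S.sort.map f)
  rw [hmap, hmap, hsort]
  refine List.prod_map_filter_of_eq_one _ _ _ fun i hi hiT => ?_
  exact (QuotientGroup.eq_one_iff _).2 (h i (by simpa using hi) (by simpa using hiT))

/-- Cut both products at `j`: they read `p * f j * a` and `p * b` with the same `p` and with `a, b ∈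
V`. The second gives `p ∈ V`, then the first gives `f j ∈ V`; normality of `V` is not needed. -/
theorem Finset.mem_of_orderedProd_mem {T : Finset I} {f g : I → H} {j : I} (hj : j ∈ T)
    (hlt : ∀ i ∈ T, i < j → f i = g i) (hg : g j = 1) (V : Subgroup H)
    (hfV : ∀ i ∈ T, j < i → f i ∈ V) (hgV : ∀ i ∈ T, j < i → g i ∈ V)
    (hf : T.orderedProd f ∈ V) (hg' : T.orderedProd g ∈ V) : f j ∈ V := by
  obtain ⟨l₁, l₂, hl⟩ := List.append_of_mem ((Finset.mem_sort (· ≤ ·)).2 hj)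
  have hs : List.Pairwise (· < ·) T.sort := T.sortedLT_sort.pairwise
  have hm : ∀ i, i ∈ T.sort → i ∈ T := fun i => (Finset.mem_sort (· ≤ ·)).1
  rw [hl] at hs hm
  rw [List.pairwise_append, List.pairwise_cons] at hs
  have h1 : l₁.map f = l₁.map g := List.map_congr_left fun i hi =>
    hlt i (hm i (by simp [hi])) (hs.2.2 i hi j (by simp))
  have h2 : ∀ k : I → H, (∀ i ∈ T, j < i → k i ∈ V) → (l₂.map k).prod ∈ V := by
    intro k hk
    refine V.list_prod_mem fun x hx => ?_
    obtain ⟨i, hi, rfl⟩ := List.mem_map.1 hx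
    exact hk i (hm i (by simp [hi])) (hs.2.1.1 i hi)
  have hf2 := h2 f hfV
  have hg2 := h2 g hgV
  simp only [Finset.orderedProd, hl, List.map_append, List.map_cons, List.prod_append,
    List.prod_cons, hg, one_mul, h1] at hf hg'
  have h3 : (l₁.map g).prod ∈ V := (V.mul_mem_cancel_right hg2).1 hg'
  rwa [V.mul_mem_cancel_left h3, V.mul_mem_cancel_right hf2] at hf

end orderedProd

/-- If the Boolean algebra of clopen sets of `X` is infinite and at least as large as the set of
open normal subgroups of a profinite group `H`, then `H` is topologically generated by a continuous
image of `X`. -/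
theorem exists_continuous_generating_map {X H : Type u} [TopologicalSpace X]
    [Group H] [TopologicalSpace H] [IsTopologicalGroup H] [CompactSpace H]
    [TotallyDisconnectedSpace H] [Infinite (Clopens X)]
    (hXH : #(OpenNormalSubgroup H) ≤ #(Clopens X)) :
    ∃ φ : X → H, Continuous φ ∧ ∀ V : Subgroup H, IsOpen (V : Set H) → (∀ x, φ x ∈ V) → V = ⊤ := by
  classical
  obtain ⟨I, s, hI, hs, hgen⟩ := exists_generators_converging_to_one _ (aleph0_le_mk _) hXH
  obtain ⟨J, _, C', hJ, hC'⟩ := exists_independent_clopens (X := X)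
  rw [← hJ] at hI
  obtain ⟨e⟩ := hI
  let : LinearOrder I := LinearOrder.lift' e e.injective
  let C : I → Clopens X := fun i => C' (e i)
  have hC : ∀ (j : I) (T : Finset I), (∀ i ∈ T, i < j) →
      ∃ x ∈ C j, ∃ y ∉ C j, ∀ i ∈ T, (x ∈ C i ↔ y ∈ C i) := by
    intro j T hT
    obtain ⟨x, hx, y, hy, h⟩ := hC' (e j) (T.map e) (by
      intro i hi
      obtain ⟨i, hiT, rfl⟩ := Finset.mem_map.1 hi
      exact hT i hiT)
    exact ⟨x, hx, y, hy, fun i hi => h (e i) (Finset.mem_map_of_mem _ hi)⟩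
  let F : OpenNormalSubgroup H → Finset I := fun U => (hs U).toFinset
  have hF : ∀ U i, i ∈ F U ↔ s i ∉ U := fun U i => by simp [F]
  let f : X → I → H := fun x i => if x ∈ C i then s i else 1
  have hfU : ∀ U x i, i ∉ F U → f x i ∈ U := by
    intro U x i hi
    rw [hF, not_not] at hi
    simp only [f]
    split_ifs
    · exact hi
    · exact one_mem U
  -- The infinite product exists: the cosets of the partial products are closed and decrease with
  -- `U`, so they have a common point.
  have hex : ∀ x, ∃ h : H, ∀ U, ((F U).orderedProd (f x))⁻¹ * h ∈ U := by
    intro x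
    let A : OpenNormalSubgroup H → Set H := fun U =>
      (fun h => ((F U).orderedProd (f x))⁻¹ * h) ⁻¹' (U : Set H)
    have hA : ∀ U, IsClosed (A U) := fun U =>
      U.toOpenSubgroup.isClosed.preimage (continuous_const_mul _)
    have hmono : ∀ U V : OpenNormalSubgroup H, U ≤ V → A U ⊆ A V := by
      intro U V hUV h (hh : ((F U).orderedProd (f x))⁻¹ * h ∈ U)
      have hsub : F V ⊆ F U := fun i hi => by
        rw [hF] at hi ⊢
        exact fun h => hi (hUV h)
      have := Finset.orderedProd_subset hsub (f := f x) V.toSubgroup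
        fun i _ hi => hfU V x i hi
      have := mul_mem this (hUV hh)
      rwa [mul_assoc, mul_inv_cancel_left] at this
    have : Nonempty (OpenNormalSubgroup H) := by
      obtain ⟨U, -⟩ := ProfiniteGrp.exist_openNormalSubgroup_sub_open_nhds_of_one
        (G := H) isOpen_univ trivial
      exact ⟨U⟩
    obtain ⟨h, hh⟩ := IsCompact.nonempty_iInter_of_directed_nonempty_isCompact_isClosed A
      (fun U V => ⟨U ⊓ V, hmono _ _ inf_le_left, hmono _ _ inf_le_right⟩)
      (fun U => ⟨(F U).orderedProd (f x), by simp [A]⟩)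
      (fun U => (hA U).isCompact) hA
    exact ⟨h, fun U => Set.mem_iInter.1 hh U⟩
  choose φ hφ using hex
  refine ⟨φ, ?_, ?_⟩
  · rw [continuous_iff_continuousAt]
    intro x W hW
    have hW' : (fun h => φ x * h) ⁻¹' W ∈ nhds (1 : H) :=
      (continuous_const_mul (φ x)).continuousAt.preimage_mem_nhds (by simpa using hW)
    obtain ⟨W', hW'W, hW'o, h1⟩ := mem_nhds_iff.1 hW'
    obtain ⟨U, hU⟩ := ProfiniteGrp.exist_openNormalSubgroup_sub_open_nhds_of_one hW'o h1
    -- Modulo `U` the value at `x` depends only on membership in the finitely many clopen sets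
    -- indexed by `F U`.
    have hev : ∀ᶠ y in nhds x, ∀ i ∈ F U, (y ∈ C i ↔ x ∈ C i) := by
      refine (Filter.eventually_all_finset _).2 fun i _ => ?_
      by_cases hx : x ∈ C i
      · filter_upwards [(C i).isClopen.isOpen.mem_nhds hx] with y hy
        exact iff_of_true hy hx
      · filter_upwards [(C i).isClopen.isClosed.isOpen_compl.mem_nhds hx] with y hy
        exact iff_of_false hy hx
    change ∀ᶠ y in nhds x, φ y ∈ W
    filter_upwards [hev] with y hy
    have hxy : (F U).orderedProd (f x) = (F U).orderedProd (f y) :=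
      Finset.orderedProd_congr fun i hi => by simp only [f, hy i hi]
    have h2 := hφ x U
    rw [hxy] at h2
    have : (φ x)⁻¹ * φ y ∈ U := by
      simpa [mul_assoc] using mul_mem (inv_mem h2) (hφ y U)
    simpa using hW'W (hU this)
  · intro V hV hφV
    obtain ⟨U, hU⟩ := ProfiniteGrp.exist_openNormalSubgroup_sub_open_nhds_of_one hV V.one_mem
    have hP : ∀ x, (F U).orderedProd (f x) ∈ V := by
      intro x
      have := V.mul_mem (hφV x) (V.inv_mem (hU (hφ x U)))
      simpa using this
    refine hgen V U hU ?_
    by_contra! hne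
    have hne' : ((F U).filter fun i => s i ∉ V).Nonempty := by
      obtain ⟨i, hi⟩ := hne
      exact ⟨i, Finset.mem_filter.2 ⟨(hF U i).2 fun h => hi (hU h), hi⟩⟩
    -- The last index with `s j ∉ V`: all later factors lie in `V`, while independence supplies two
    -- points whose earlier factors agree.
    obtain ⟨j, hj, hmax⟩ := Finset.exists_max_image _ id hne'
    rw [Finset.mem_filter] at hj
    obtain ⟨x, hx, y, hy, hxy⟩ := hC j ((F U).filter (· < j)) fun i hi =>
      (Finset.mem_filter.1 hi).2
    have hgt : ∀ z, ∀ i ∈ F U, j < i → f z i ∈ V := by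
      intro z i hi hji
      simp only [f]
      split_ifs
      · by_contra hiV
        exact (hmax i (Finset.mem_filter.2 ⟨hi, hiV⟩)).not_gt hji
      · exact V.one_mem
    have := Finset.mem_of_orderedProd_mem (f := f x) (g := f y) hj.1
      (fun i hi hij => by simp only [f, hxy i (Finset.mem_filter.2 ⟨hi, hij⟩)])
      (by simp [f, hy]) V (hgt x) (hgt y) (hP x) (hP y)
    simp only [f, if_pos hx] at this
    exact hj.2 this

/-! ### Weight and universality of free profinite groups -/

section
variable {X : Type u} [TopologicalSpace X]

theorem ContinuousMonoidHom.nonempty_quotient_ker_continuousMulEquiv {G H : Type*} [Group G]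
    [TopologicalSpace G] [CompactSpace G] [Group H] [TopologicalSpace H] [T2Space H]
    (Φ : G →ₜ* H) (hΦ : Function.Surjective Φ) :
    Nonempty ((G ⧸ Φ.toMonoidHom.ker) ≃ₜ* H) := by
  let e : G ⧸ Φ.toMonoidHom.ker ≃* H :=
    QuotientGroup.quotientKerEquivOfSurjective Φ.toMonoidHom hΦ
  have he : Continuous e.toEquiv :=
    continuous_quot_lift _ Φ.continuous_toFun
  exact ⟨{ e with
    continuous_toFun := he
    continuous_invFun := he.continuous_symm_of_equiv_compact_to_t2 }⟩

/-- The cosets of open normal subgroups form a base, and each such subgroup has finite index. -/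
theorem topWeight_le_of_mk_openNormalSubgroup_le {G : Type u} [Group G] [TopologicalSpace G]
    [IsTopologicalGroup G] [CompactSpace G] [TotallyDisconnectedSpace G] {m : Cardinal.{u}}
    (hm : ℵ₀ ≤ m) (h : #(OpenNormalSubgroup G) ≤ m) : topWeight G ≤ m := by
  let B : (Σ U : OpenNormalSubgroup G, G ⧸ U.toSubgroup) → Set G :=
    fun p => QuotientGroup.mk ⁻¹' {p.2}
  have hB : IsTopologicalBasis (Set.range B) := by
    refine isTopologicalBasis_of_isOpen_of_nhds ?_ ?_
    · rintro _ ⟨⟨U, c⟩, rfl⟩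
      have : DiscreteTopology (G ⧸ U.toSubgroup) :=
        inferInstanceAs (DiscreteTopology (G ⧸ U.toOpenSubgroup.toSubgroup))
      exact (isOpen_discrete {c}).preimage QuotientGroup.continuous_mk
    · intro g W hg hW
      obtain ⟨U, hU⟩ := ProfiniteGrp.exist_openNormalSubgroup_sub_open_nhds_of_one
        (hW.preimage (continuous_const_mul g)) (by simpa using hg)
      refine ⟨_, ⟨⟨U, (g : G ⧸ U.toSubgroup)⟩, rfl⟩, rfl, fun x hx => ?_⟩
      have hx : (g : G ⧸ U.toSubgroup) = x := hx.symm
      simpa using hU (QuotientGroup.eq.1 hx)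
  refine (topWeight_le_mk hB).trans (mk_range_le.trans (mk_sigma_le_of_le hm h fun U => ?_))
  have : Finite (G ⧸ U.toSubgroup) :=
    inferInstanceAs (Finite (G ⧸ U.toOpenSubgroup.toSubgroup))
  exact (lt_aleph0_of_finite _).le.trans hm

theorem mk_openNormalSubgroup_le_mk_clopens {G : Type u} [Group G] [TopologicalSpace G]
    [IsTopologicalGroup G] : #(OpenNormalSubgroup G) ≤ #(Clopens G) :=
  mk_le_of_injective (f := fun U => (⟨U, U.toOpenSubgroup.isClopen⟩ : Clopens G))
    fun _ _ h => SetLike.coe_injective (congrArg Clopens.carrier h)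

namespace IsFreeProfiniteGroup
variable {F : ProfiniteGrp.{u}} {i : X → F}

theorem hom_ext (hF : IsFreeProfiniteGroup X F i) {G : ProfiniteGrp.{u}} {Φ Ψ : F →ₜ* G}
    (h : ∀ x, Φ (i x) = Ψ (i x)) : Φ = Ψ := by
  obtain ⟨Θ, -, hΘ⟩ := hF.existsUnique_lift G (fun x => Ψ (i x))
    (Ψ.continuous_toFun.comp hF.continuous_i)
  rw [hΘ Φ h, hΘ Ψ fun _ => rfl]

/-- The code of `U` is the multiplication table of `F ⧸ U` on some `Fin n` together with the clopen
fibres of `X → F ⧸ U`. Equal codes give an isomorphism `F ⧸ U ≃* F ⧸ V` matching the images of `X`.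
By uniqueness of lifts it carries one quotient map to the other, so the kernels coincide. -/
theorem mk_openNormalSubgroup_le (hF : IsFreeProfiniteGroup X F i) {m : Cardinal.{u}}
    (hm : ℵ₀ ≤ m) (hX : #(Clopens X) ≤ m) : #(OpenNormalSubgroup F) ≤ m := by
  let D : Type u := Σ n : ULift.{u} ℕ,
    ULift.{u} (Fin n.down → Fin n.down → Fin n.down) × (Fin n.down → Clopens X)
  have hD : #D ≤ m := by
    refine mk_sigma_le_of_le hm (by simpa using hm) fun n => ?_
    rw [mk_prod, lift_id, lift_id]
    refine mul_le_of_le hm ((lt_aleph0_of_finite _).le.trans hm) ?_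
    simp only [mk_pi, prod_const, mk_fin, lift_natCast, lift_uzero]
    exact (power_le_power_right hX).trans (power_nat_le hm)
  have hdisc : ∀ U : OpenNormalSubgroup F, DiscreteTopology (F ⧸ U.toSubgroup) := fun U =>
    inferInstanceAs (DiscreteTopology (F ⧸ U.toOpenSubgroup.toSubgroup))
  have hcode : ∀ U : OpenNormalSubgroup F, ∃ d : D, ∃ e : F ⧸ U.toSubgroup ≃ Fin d.1.down,
      (∀ a b, e (a * b) = d.2.1.down (e a) (e b)) ∧
      ∀ x k, x ∈ d.2.2 k ↔ e (i x) = k := by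
    intro U
    have : Finite (F ⧸ U.toSubgroup) :=
      inferInstanceAs (Finite (F ⧸ U.toOpenSubgroup.toSubgroup))
    obtain ⟨n, ⟨e⟩⟩ := Finite.exists_equiv_fin (F ⧸ U.toSubgroup)
    have hc : Continuous fun x => (i x : F ⧸ U.toSubgroup) :=
      QuotientGroup.continuous_mk.comp hF.continuous_i
    refine ⟨⟨⟨n⟩, ⟨fun a b => e (e.symm a * e.symm b)⟩, fun k =>
      ⟨(fun x => (i x : F ⧸ U.toSubgroup)) ⁻¹' {e.symm k},
        (isClopen_discrete _).preimage hc⟩⟩, e, by simp, fun x k => ?_⟩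
    change (i x : F ⧸ U.toSubgroup) = e.symm k ↔ _
    rw [Equiv.eq_symm_apply]
  choose d hd using hcode
  refine (mk_le_of_injective (f := d) fun U V hUV => ?_).trans hD
  have key : ∃ q : F ⧸ U.toSubgroup ≃* F ⧸ V.toSubgroup,
      ∀ x, q (i x : F ⧸ U.toSubgroup) = (i x : F ⧸ V.toSubgroup) := by
    have hU := hd U
    rw [hUV] at hU
    obtain ⟨e, he, hei⟩ := hU
    obtain ⟨e', he', hei'⟩ := hd V
    refine ⟨{ e.trans e'.symm with map_mul' := fun a b => ?_ }, fun x => ?_⟩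
    · simp [Equiv.symm_apply_eq, he, he']
    · change e'.symm (e _) = _
      rw [Equiv.symm_apply_eq, eq_comm, ← hei', hei]
  obtain ⟨q, hq⟩ := key
  let Φ : F →ₜ* F ⧸ V.toSubgroup :=
    { QuotientGroup.mk' V.toSubgroup with continuous_toFun := QuotientGroup.continuous_mk }
  let Ψ : F →ₜ* F ⧸ V.toSubgroup :=
    { q.toMonoidHom.comp (QuotientGroup.mk' U.toSubgroup) with
      continuous_toFun := (continuous_of_discreteTopology (f := q)).comp
        QuotientGroup.continuous_mk }
  have h : Φ = Ψ := hF.hom_ext (G := ProfiniteGrp.of (F ⧸ V.toSubgroup)) fun x => (hq x).symm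
  refine SetLike.ext fun g => ?_
  have hg : (g : F ⧸ V.toSubgroup) = q (g : F ⧸ U.toSubgroup) := DFunLike.congr_fun h g
  change g ∈ U.toSubgroup ↔ g ∈ V.toSubgroup
  rw [← QuotientGroup.eq_one_iff, ← QuotientGroup.eq_one_iff, hg, map_eq_one_iff q q.injective]

theorem isSurjectivelyUniversal (hF : IsFreeProfiniteGroup X F i) {m : Cardinal.{u}}
    (hm : ℵ₀ ≤ m) (hX : #(Clopens X) = m) : IsSurjectivelyUniversal (ProOfWeightLE m) F := by
  refine ⟨topWeight_le_of_mk_openNormalSubgroup_le hm (hF.mk_openNormalSubgroup_le hm hX.le),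
    fun H hH => ?_⟩
  have : Infinite (Clopens X) := infinite_iff.2 (hm.trans_eq hX.symm)
  obtain ⟨φ, hφ, hgen⟩ := exists_continuous_generating_map (X := X) (H := H)
    ((mk_openNormalSubgroup_le_mk_clopens.trans
      (mk_clopens_le_of_topWeight_le hm hH)).trans_eq hX.symm)
  obtain ⟨Φ, hΦ, -⟩ := hF.existsUnique_lift H φ hφ
  have hsurj : Function.Surjective Φ := by
    -- The image is compact, hence closed, hence the intersection of the open subgroups containing
    -- it; each of these contains `φ` of every point and so is everything.
    let R : ClosedSubgroup H :=
      { toSubgroup := Φ.toMonoidHom.range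
        isClosed' := (isCompact_range Φ.continuous_toFun).isClosed }
    have hR : (R : Subgroup H) = ⊤ := by
      rw [ProfiniteGrp.closedSubgroup_eq_sInf_open R, sInf_eq_top]
      rintro V ⟨hV, hRV⟩
      exact hgen V hV fun x => hRV ⟨i x, hΦ x⟩
    exact MonoidHom.range_eq_top.1 hR
  exact ⟨Φ.toMonoidHom.ker, inferInstance, Φ.nonempty_quotient_ker_continuousMulEquiv hsurj⟩

end IsFreeProfiniteGroup
end

/-! ### Existence of free profinite groups -/

section
variable {X : Type u} [TopologicalSpace X]

/-- The hypothesis says that `ψ` is continuous for the topology induced by `D`. The closure of the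
joint image in `P × G` is then the graph of a homomorphism: its fibre over `1` is trivial, and
compactness makes its projection the whole closure. A closed graph with compact target gives
continuity. -/
theorem MonoidHom.exists_extension_to_closure_range {W P G : Type*} [Group W] [Group P] [TopologicalSpace P]
    [IsTopologicalGroup P] [CompactSpace P] [T2Space P] [Group G] [TopologicalSpace G]
    [IsTopologicalGroup G] [CompactSpace G] [TotallyDisconnectedSpace G]
    (D : W →* P) (ψ : W →* G)
    (h : ∀ U : OpenNormalSubgroup G, ∃ O : Set P, IsOpen O ∧ 1 ∈ O ∧
      ∀ w, D w ∈ O → ψ w ∈ U) :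
    ∃ Φ : D.range.topologicalClosure →ₜ* G,
      ∀ w, Φ ⟨D w, subset_closure ⟨w, rfl⟩⟩ = ψ w := by
  let Γ : Subgroup (P × G) := (D.prod ψ).range.topologicalClosure
  have hΓc : IsClosed (Γ : Set (P × G)) := Subgroup.isClosed_topologicalClosure _
  have hmem : ∀ w, (D w, ψ w) ∈ Γ := fun w => subset_closure ⟨w, rfl⟩
  have hone : ∀ g, ((1 : P), g) ∈ Γ → g = 1 := by
    intro g hg
    by_contra hne
    obtain ⟨U, hU⟩ := ProfiniteGrp.exist_openNormalSubgroup_sub_open_nhds_of_one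
      (isOpen_compl_singleton (x := g)) (fun h1 => hne h1.symm)
    obtain ⟨O, hO, hO1, hOU⟩ := h U
    have hnhds : O ×ˢ ((fun x => g⁻¹ * x) ⁻¹' (U : Set G)) ∈ nhds ((1 : P), g) := by
      refine prod_mem_nhds (hO.mem_nhds hO1)
        ((U.toOpenSubgroup.isOpen.preimage (continuous_const_mul _)).mem_nhds ?_)
      change g⁻¹ * g ∈ U
      simp
    obtain ⟨_, ⟨h1, h2⟩, w, rfl⟩ := mem_closure_iff_nhds.1 hg _ hnhds
    have h3 : g⁻¹ * ψ w ∈ U := h2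
    have h4 : g ∈ U := by simpa using mul_mem (hOU w h1) (inv_mem h3)
    exact hU h4 rfl
  have huniq : ∀ p g g', (p, g) ∈ Γ → (p, g') ∈ Γ → g = g' := by
    intro p g g' hg hg'
    have := Γ.mul_mem (Γ.inv_mem hg) hg'
    exact inv_mul_eq_one.1 (hone _ (by simpa using this))
  have hex : ∀ p : D.range.topologicalClosure, ∃ g, (p.1, g) ∈ Γ := by
    rintro ⟨p, hp⟩
    have hc : IsClosed (Prod.fst '' (Γ : Set (P × G))) :=
      (hΓc.isCompact.image continuous_fst).isClosed
    have : closure (Set.range D) ⊆ Prod.fst '' (Γ : Set (P × G)) :=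
      closure_minimal (by rintro _ ⟨w, rfl⟩; exact ⟨_, hmem w, rfl⟩) hc
    obtain ⟨⟨p', g⟩, hg, rfl⟩ := this hp
    exact ⟨g, hg⟩
  choose Φ hΦ using hex
  refine ⟨⟨⟨⟨Φ, ?_⟩, ?_⟩, ?_⟩, fun w => huniq _ _ _ (hΦ _) (hmem w)⟩
  · exact hone _ (hΦ 1)
  · intro p q
    exact huniq _ _ _ (hΦ _) (Γ.mul_mem (hΦ p) (hΦ q))
  · change Continuous Φ
    rw [continuous_iff_isClosed]
    intro K hK
    have hA : IsClosed {x : D.range.topologicalClosure × G | (x.1.1, x.2) ∈ Γ ∧ x.2 ∈ K} :=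
      (hΓc.preimage ((continuous_subtype_val.comp continuous_fst).prodMk continuous_snd)).inter
        (hK.preimage continuous_snd)
    convert isClosedMap_fst_of_compactSpace _ hA using 1
    ext p
    constructor
    · exact fun hp => ⟨(p, Φ p), ⟨hΦ p, hp⟩, rfl⟩
    · rintro ⟨⟨p', g⟩, ⟨hg, hgK⟩, rfl⟩
      change Φ p' ∈ K
      rwa [huniq _ _ _ (hΦ p') hg]

/-- The kernels of homomorphisms from the free group on `X` to finite discrete groups that are
continuous on `X`. -/
def ContinuousFiniteIndexSubgroup (X : Type u) [TopologicalSpace X] : Type u :=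
  {N : Subgroup (FreeGroup X) // N.Normal ∧ Finite (FreeGroup X ⧸ N) ∧
    ∀ x, IsOpen
      {y | (QuotientGroup.mk (FreeGroup.of y) : FreeGroup X ⧸ N) = QuotientGroup.mk (FreeGroup.of x)}}

namespace ContinuousFiniteIndexSubgroup

/-- The finite discrete quotient of the free group attached to a finite-index subgroup. -/
def Quotient (N : ContinuousFiniteIndexSubgroup X) : Type u := FreeGroup X ⧸ N.1

variable (N : ContinuousFiniteIndexSubgroup X)

noncomputable instance : Group N.Quotient :=
  letI := N.2.1
  inferInstanceAs (Group (FreeGroup X ⧸ N.1))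

instance : TopologicalSpace N.Quotient := ⊥

instance : DiscreteTopology N.Quotient := ⟨rfl⟩

instance : Finite N.Quotient := N.2.2.1

/-- The quotient map. -/
noncomputable def mk : FreeGroup X →* N.Quotient :=
  letI := N.2.1
  QuotientGroup.mk' N.1

theorem mk_eq_one_iff (w : FreeGroup X) : N.mk w = 1 ↔ w ∈ N.1 :=
  letI := N.2.1
  QuotientGroup.eq_one_iff w

theorem continuous_mk_of : Continuous fun x => N.mk (FreeGroup.of x) := by
  refine continuous_discrete_rng.2 fun c => ?_
  rw [isOpen_iff_mem_nhds]
  rintro x rfl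
  exact (N.2.2.2 x).mem_nhds rfl

/-- The product of all finite quotient maps. -/
noncomputable def mkPi (X : Type u) [TopologicalSpace X] :
    FreeGroup X →* ∀ N : ContinuousFiniteIndexSubgroup X, N.Quotient :=
  MonoidHom.pi mk

end ContinuousFiniteIndexSubgroup

-- The free profinite group is the closure of the abstract free group in the product of its finite
-- quotients that are continuous on `X`. Lifts exist by extension to the closure and are unique by
-- density.
open ContinuousFiniteIndexSubgroup in
theorem exists_isFreeProfiniteGroup (X : Type u) [TopologicalSpace X] :
    ∃ (F : ProfiniteGrp.{u}) (i : X → F), IsFreeProfiniteGroup X F i := by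
  let K := (mkPi X).range.topologicalClosure
  have hK : CompactSpace K :=
    isCompact_iff_compactSpace.1 (Subgroup.isClosed_topologicalClosure _).isCompact
  have hmem : ∀ w, mkPi X w ∈ K := fun w => subset_closure ⟨w, rfl⟩
  refine ⟨ProfiniteGrp.of K, fun x => ⟨mkPi X (FreeGroup.of x), hmem _⟩, ⟨?_, ?_⟩⟩
  · exact (continuous_pi fun N => N.continuous_mk_of).subtype_mk _
  · intro G φ hφ
    obtain ⟨Φ, hΦ⟩ := MonoidHom.exists_extension_to_closure_range (mkPi X) (FreeGroup.lift φ) (by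
      intro U
      have hdisc : DiscreteTopology (G ⧸ U.toSubgroup) :=
        inferInstanceAs (DiscreteTopology (G ⧸ U.toOpenSubgroup.toSubgroup))
      have hfin : Finite (G ⧸ U.toSubgroup) :=
        inferInstanceAs (Finite (G ⧸ U.toOpenSubgroup.toSubgroup))
      let q : FreeGroup X →* G ⧸ U.toSubgroup :=
        (QuotientGroup.mk' U.toSubgroup).comp (FreeGroup.lift φ)
      -- The kernel modulo `U` is itself one of the factors, so triviality of coordinate `N` is an
      -- open condition forcing the lift into `U`.
      let N : ContinuousFiniteIndexSubgroup X := ⟨q.ker, inferInstance,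
        Finite.of_injective _ (QuotientGroup.kerLift_injective q), fun x => by
          have hc : Continuous fun y => (φ y : G ⧸ U.toSubgroup) :=
            QuotientGroup.continuous_mk.comp hφ
          convert (isOpen_discrete {(φ x : G ⧸ U.toSubgroup)}).preimage hc using 1
          ext y
          change (QuotientGroup.mk (FreeGroup.of y) : FreeGroup X ⧸ q.ker) =
              QuotientGroup.mk (FreeGroup.of x) ↔
            (φ y : G ⧸ U.toSubgroup) = φ x
          rw [← (QuotientGroup.kerLift_injective q).eq_iff]
          simp [q]⟩
      refine ⟨{p | p N = 1}, (isOpen_discrete {(1 : N.Quotient)}).preimage (continuous_apply N),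
        rfl, fun w hw => ?_⟩
      have hw : w ∈ q.ker := (N.mk_eq_one_iff w).1 hw
      exact (QuotientGroup.eq_one_iff _).1 hw)
    refine ⟨Φ, fun x => (hΦ _).trans (by simp), fun Ψ hΨ => ?_⟩
    let Ψ' : K →ₜ* G := Ψ
    have hw : ∀ w, Ψ' ⟨mkPi X w, hmem w⟩ = Φ ⟨mkPi X w, hmem w⟩ := by
      have : Ψ'.toMonoidHom.comp ((mkPi X).codRestrict K hmem) =
          Φ.toMonoidHom.comp ((mkPi X).codRestrict K hmem) :=
        FreeGroup.ext_hom _ _ fun x => (hΨ x).trans ((hΦ _).trans (by simp)).symm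
      exact fun w => DFunLike.congr_fun this w
    have hdense : DenseRange fun w => (⟨mkPi X w, hmem w⟩ : K) := by
      rw [DenseRange, Subtype.dense_iff]
      intro p hp
      refine closure_mono ?_ hp
      rintro _ ⟨w, rfl⟩
      exact ⟨_, ⟨w, rfl⟩, rfl⟩
    have := hdense.equalizer Ψ'.continuous_toFun Φ.continuous_toFun (funext hw)
    exact DFunLike.coe_injective this

end

theorem theoremt (m : Cardinal.{u}) (hm : ℵ₀ ≤ m) :
    -- there is a surjectively universal group among the profinite groups of weight at most `m`
    (∃ G : ProfiniteGrp.{u}, IsSurjectivelyUniversal (ProOfWeightLE m) G) ∧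
    -- the free profinite group over the Cantor cube of weight `m` exists and is such a group
    (∀ ι : Type u, #ι = m →
      (∃ (F : ProfiniteGrp.{u}) (i : (ι → Bool) → F), IsFreeProfiniteGroup (ι → Bool) F i) ∧
      ∀ (F : ProfiniteGrp.{u}) (i : (ι → Bool) → F), IsFreeProfiniteGroup (ι → Bool) F i →
        IsSurjectivelyUniversal (ProOfWeightLE m) F) ∧
    -- the same for every infinite Stone space of weight `m`
    (∀ (X : Type u) [TopologicalSpace X] [CompactSpace X] [T2Space X]
        [TotallyDisconnectedSpace X] [Infinite X], topWeight X = m →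
      (∃ (F : ProfiniteGrp.{u}) (i : X → F), IsFreeProfiniteGroup X F i) ∧
      ∀ (F : ProfiniteGrp.{u}) (i : X → F), IsFreeProfiniteGroup X F i →
        IsSurjectivelyUniversal (ProOfWeightLE m) F) := by
  have stone : ∀ (X : Type u) [TopologicalSpace X] [CompactSpace X] [T2Space X]
      [TotallyDisconnectedSpace X], topWeight X = m →
      ∀ (F : ProfiniteGrp.{u}) (i : X → F), IsFreeProfiniteGroup X F i →
        IsSurjectivelyUniversal (ProOfWeightLE m) F := fun X _ _ _ _ hX F i hF =>
    hF.isSurjectivelyUniversal hm <|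
      (mk_clopens_le_of_topWeight_le hm hX.le).antisymm (hX.ge.trans topWeight_le_mk_clopens)
  have cube : ∀ ι : Type u, #ι = m → topWeight (ι → Bool) = m := by
    intro ι hι
    have : Infinite ι := infinite_iff.2 (hm.trans_eq hι.symm)
    rw [topWeight_pi_bool, hι]
  refine ⟨?_, fun ι hι => ⟨exists_isFreeProfiniteGroup _, stone _ (cube ι hι)⟩,
    fun X _ _ _ _ _ hX => ⟨exists_isFreeProfiniteGroup X, stone X hX⟩⟩
  obtain ⟨F, i, hF⟩ := exists_isFreeProfiniteGroup (m.out → Bool)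
  exact ⟨F, stone _ (cube _ m.mk_out) F i hF⟩
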